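/- Let $\mathcal A$ be a complex unital Banach algebra with unit $1$. An element $a\in\mathcal A$ is called Drazin invertible if there is $b\in\mathcal A$ with $ab=ba$, $bab=b$ and $(a(1-ab))^n=0$ for some $n\in\mathbb N$; it is called g-Drazin invertible if there is $b\in\mathcal A$ with $ab=ba$, $bab=b$ and $a(1-ab)$ quasinilpotent, i.e. of spectral radius $0$. Let $p,q\in\mathcal A$ be idempotents, let $m\ge 1$ be an integer, and let $\gamma_1,\lambda_1,\dots,\lambda_m\in\mathbb C$ with $\lambda_1\gamma_1\neq 0$. Then $$\lambda_1p+\gamma_1q-\lambda_1pq+\sum_{k=2}^m\lambda_k\left((pq)^{k-1}p-(pq)^k\right)$$ is Drazin (resp. g-Drazin) invertible if and only if $$\lambda_1-\lambda_1pq+\sum_{k=2}^m\lambda_k\left((pq)^{k-1}p-(pq)^k\right)$$ is Drazin (resp. g-Drazin) invertible. -/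

import Mathlib

section Drazin

variable {A : Type*}

/-- `b` is a Drazin inverse of `a`. -/
def IsDrazinInverse [Ring A] (a b : A) : Prop :=
  a * b = b * a ∧ b * a * b = b ∧ ∃ n : ℕ, (a * (1 - a * b)) ^ n = 0

/-- `a` is Drazin invertible. -/
def IsDrazinInvertible [Ring A] (a : A) : Prop :=
  ∃ b : A, IsDrazinInverse a b

/-- `a` is quasinilpotent: its spectral radius is zero. -/
def IsQuasinilpotent [Ring A] [Algebra ℂ A] (a : A) : Prop :=
  spectralRadius ℂ a = 0

/-- `b` is a generalized Drazin (g-Drazin) inverse of `a`. -/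
def IsGDrazinInverse [Ring A] [Algebra ℂ A] (a b : A) : Prop :=
  a * b = b * a ∧ b * a * b = b ∧ IsQuasinilpotent (a * (1 - a * b))

/-- `a` is g-Drazin invertible. -/
def IsGDrazinInvertible [Ring A] [Algebra ℂ A] (a : A) : Prop :=
  ∃ b : A, IsGDrazinInverse a b

end Drazin

/-! Both elements contain `w = λ₁(p - pq) + s`, with `s` the sum over `k ≥ 2`: they are `γ₁q + w`
and `λ₁(1 - p) + w`, where `wq = 0` and `(1 - p)w = 0`. Relative to an idempotent `e` with `we = 0`,
`ce + w` is block triangular with diagonal blocks `c ≠ 0` and `(1 - e)w`; the scalar block is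
harmless, and Cline's formula trades `(1 - e)w` for `w(1 - e) = w`. The opposite ring handles `ew =
0`. Negligibility enters only through `hN` and `hU`, so both inverses are treated at once. -/

section DrazinRelative

/-- `a` has an inner commuting inverse `b` relative to a class `N` of negligible elements:
`N` is nilpotency for Drazin inverses and quasinilpotency for g-Drazin inverses. -/
def IsDrazinInvertibleRel {A : Type*} [Ring A] (N : A → Prop) (a : A) : Prop :=
  ∃ b : A, a * b = b * a ∧ b * a * b = b ∧ N (a * (1 - a * b))

/-- Cline's formula. -/
theorem IsDrazinInvertibleRel.mul_comm {A : Type*} [Ring A] {N : A → Prop}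
    (hN : ∀ x y, N (x * y) → N (y * x)) {a b : A}
    (h : IsDrazinInvertibleRel N (a * b)) : IsDrazinInvertibleRel N (b * a) := by
  obtain ⟨d, h1, h2, h3⟩ := h
  have e1 : b * a * (b * d * d * a) = b * d * a := by
    calc b * a * (b * d * d * a) = b * (a * b * d * d) * a := by noncomm_ring
      _ = b * d * a := by rw [h1, h2]
  have e2 : b * d * d * a * (b * a) = b * d * a := by
    calc b * d * d * a * (b * a) = b * (d * (d * (a * b))) * a := by noncomm_ring
      _ = b * d * a := by rw [← h1, ← mul_assoc d, h2]
  refine ⟨b * d * d * a, e1.trans e2.symm, ?_, ?_⟩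
  · rw [e2]
    calc b * d * a * (b * d * d * a) = b * d * (a * b * d) * d * a := by noncomm_ring
      _ = b * d * (d * (a * b) * d) * a := by rw [h1]; simp only [mul_assoc]
      _ = b * d * d * a := by rw [h2]
  · rw [e1]
    -- Swapping the factors of this residual gives the residual of `a * b`.
    have e3 : b * a * (1 - b * d * a) = b * ((1 - a * b * d) * a) := by noncomm_ring
    rw [e3]
    apply hN
    have e4 : (1 - a * b * d) * a * b = a * b * (1 - a * b * d) := by
      calc (1 - a * b * d) * a * b = a * b - a * b * (d * (a * b)) := by noncomm_ring
        _ = a * b - a * b * (a * b * d) := by rw [h1]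
        _ = a * b * (1 - a * b * d) := by noncomm_ring
    rwa [e4]

/-! ### Splitting off a nonzero scalar block -/

variable {K A : Type*} [Field K] [Ring A] [Algebra K A] {N : A → Prop}

/-- Since `xe = ce` with `c ≠ 0`, the spectral idempotent `1 - xb` kills `e`. Hence `be = c⁻¹e`, so
`b` is triangular too and compresses to an inverse of `(1 - e)x`. -/
theorem IsDrazinInvertibleRel.of_smul_add
    (hN : ∀ x y, N (x * y) → N (y * x))
    (hU : ∀ x, N x → ∀ c : K, c ≠ 0 → IsUnit (algebraMap K A c - x))
    {e w : A} {c : K} (hc : c ≠ 0) (he : e * e = e) (hw : w * e = 0)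
    (h : IsDrazinInvertibleRel N (c • e + w)) : IsDrazinInvertibleRel N w := by
  obtain ⟨b, h1, h2, h3⟩ := h
  generalize hx : c • e + w = x at h1 h2 h3
  have hxe : x * e = c • e := by rw [← hx, add_mul, hw, smul_mul_assoc, he, add_zero]
  have hxf : x * (1 - e) = w := by rw [mul_sub, hxe, mul_one, ← hx]; abel
  obtain ⟨R, hR⟩ := (hU _ h3 c hc).exists_left_inv
  have hpi : (1 - x * b) * (1 - x * b) = 1 - x * b := by
    rw [mul_sub, mul_one, sub_mul, one_mul, h1, mul_assoc b x, ← mul_assoc x b x, ← mul_assoc b,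
      ← mul_assoc b x b, h2, sub_self, sub_zero]
  have hpx : x * (1 - x * b) = (1 - x * b) * x := by
    rw [mul_sub, sub_mul, mul_assoc x b x, ← h1, mul_one, one_mul]
  have hpe : (1 - x * b) * e = 0 := by
    have : (algebraMap K A c - x * (1 - x * b)) * ((1 - x * b) * e) = 0 := by
      rw [sub_mul, ← mul_assoc (x * (1 - x * b)), mul_assoc x, hpi, hpx, mul_assoc _ x e, hxe,
        ← Algebra.smul_def, mul_smul_comm, sub_self]
    calc (1 - x * b) * e
        = R * (algebraMap K A c - x * (1 - x * b)) * ((1 - x * b) * e) := by rw [hR, one_mul]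
      _ = 0 := by rw [mul_assoc, this, mul_zero]
  have hbe : b * e = c⁻¹ • e := by
    have : e = c • (b * e) := by
      rw [← mul_smul_comm, ← hxe, ← mul_assoc, ← h1]
      rw [sub_mul, one_mul] at hpe
      exact sub_eq_zero.1 hpe
    rw [eq_inv_smul_iff₀ hc, ← this]
  have hfxf : (1 - e) * x * (1 - e) = (1 - e) * x := by
    rw [mul_sub, mul_assoc _ x e, hxe, mul_smul_comm, sub_mul 1 e e, he, one_mul, sub_self,
      smul_zero, sub_zero, mul_one]
  have hfbf : (1 - e) * b * (1 - e) = (1 - e) * b := by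
    rw [mul_sub, mul_assoc _ b e, hbe, mul_smul_comm, sub_mul 1 e e, he, one_mul, sub_self,
      smul_zero, sub_zero, mul_one]
  have e1 : (1 - e) * x * ((1 - e) * b) = (1 - e) * (x * b) := by
    rw [← mul_assoc, hfxf, mul_assoc]
  have e2 : (1 - e) * b * ((1 - e) * x) = (1 - e) * (x * b) := by
    rw [← mul_assoc, hfbf, mul_assoc, h1]
  rw [← hxf]
  apply IsDrazinInvertibleRel.mul_comm hN
  refine ⟨(1 - e) * b, e1.trans e2.symm, ?_, ?_⟩
  · rw [mul_assoc, e1, ← mul_assoc, hfbf, mul_assoc, ← mul_assoc b, h2]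
  · have hpf : (1 - x * b) * (1 - e) = 1 - x * b := by rw [mul_sub, hpe, mul_one, sub_zero]
    have e3 : (1 - e) * x * (1 - (1 - e) * (x * b)) = (1 - e) * (x * (1 - x * b)) := by
      rw [mul_sub, ← mul_assoc ((1 - e) * x), hfxf, mul_one, mul_assoc, ← mul_sub, ← mul_one_sub]
    rw [e1, e3]
    apply hN
    rwa [mul_assoc, hpf]

theorem IsDrazinInvertibleRel.smul_add
    (hN : ∀ x y, N (x * y) → N (y * x))
    (hU : ∀ x, N x → ∀ c : K, c ≠ 0 → IsUnit (algebraMap K A c - x))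
    {e w : A} {c : K} (hc : c ≠ 0) (he : e * e = e) (hw : w * e = 0)
    (h : IsDrazinInvertibleRel N w) : IsDrazinInvertibleRel N (c • e + w) := by
  have hwf : w * (1 - e) = w := by rw [mul_sub, hw, mul_one, sub_zero]
  rw [← hwf] at h
  obtain ⟨v, h1, h2, h3⟩ := h.mul_comm hN
  obtain ⟨u, hu⟩ : ∃ u, u = e * w := ⟨_, rfl⟩
  obtain ⟨g, hg⟩ : ∃ g, g = (1 - e) * w := ⟨_, rfl⟩
  have hwug : w = u + g := by rw [hu, hg]; noncomm_ring
  rw [← hg] at h1 h2 h3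
  have ge : g * e = 0 := by rw [hg, mul_assoc, hw, mul_zero]
  have eg : e * g = 0 := by rw [hg, ← mul_assoc, mul_sub, he, mul_one, sub_self, zero_mul]
  have eu : e * u = u := by rw [hu, ← mul_assoc, he]
  have ue : u * e = 0 := by rw [hu, mul_assoc, hw, mul_zero]
  have ve : v * e = 0 := by rw [← h2, mul_assoc v, h1, mul_assoc, mul_assoc, ge]; simp
  have ev : e * v = 0 := by rw [← h2, ← h1, ← mul_assoc, ← mul_assoc, eg]; simp
  obtain ⟨p, hp⟩ : ∃ p, p = 1 - g * v := ⟨_, rfl⟩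
  rw [← hp] at h3
  have pv : p * v = 0 := by rw [hp, sub_mul, h1, h2, one_mul, sub_self]
  have pp : p * p = p := by
    nth_rw 2 [hp]
    rw [mul_sub, h1, ← mul_assoc, pv, zero_mul, mul_one, sub_zero]
  have pe : p * e = e := by rw [hp, sub_mul, mul_assoc, ve, mul_zero, one_mul, sub_zero]
  have pg : p * g = g * p := by rw [hp, sub_mul, mul_sub, mul_assoc, ← h1, one_mul, mul_one]
  obtain ⟨R, hR, hR'⟩ := isUnit_iff_exists.1 (hU _ h3 c hc)
  have Rn : c • R = 1 + R * (g * p) := by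
    rw [mul_sub, ← Algebra.commutes, ← Algebra.smul_def] at hR'
    rw [← hR']; abel
  have Re : R * e = c⁻¹ • e := by
    rw [eq_inv_smul_iff₀ hc, ← smul_mul_assoc, Rn, add_mul, mul_assoc, mul_assoc, pe, ge]
    simp
  have pR : p * R * p = p * R := by
    have h4 : p * (algebraMap K A c - g * p) = (algebraMap K A c - g * p) * p := by
      rw [mul_sub, sub_mul, Algebra.commutes, ← mul_assoc, pg]
    have h5 : R * p = p * R := by
      calc R * p = R * (p * (algebraMap K A c - g * p)) * R := by
            rw [mul_assoc, mul_assoc, hR, mul_one]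
        _ = p * R := by rw [h4, ← mul_assoc, hR', one_mul]
    rw [mul_assoc, h5, ← mul_assoc, pp]
  -- The inverse sought has diagonal `c⁻¹`, `v` and corner `-c⁻¹uv + y`. Commuting with `ce + w`
  -- forces `yg = cy - c⁻¹up`, solved using `R = (c - gp)⁻¹`.
  obtain ⟨y, hy⟩ : ∃ y, y = c⁻¹ • (u * p * R) := ⟨_, rfl⟩
  have ye : y * e = 0 := by
    rw [hy, smul_mul_assoc, mul_assoc, Re, mul_smul_comm, mul_assoc, pe, ue]
    simp
  have ey : e * y = y := by
    rw [hy, mul_smul_comm, ← mul_assoc, ← mul_assoc, eu]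
  have yp : y * p = y := by
    rw [hy, smul_mul_assoc, mul_assoc u, mul_assoc u, pR]
  have yv : y * v = 0 := by rw [← yp, mul_assoc, pv, mul_zero]
  have yg : y * g = c • y - c⁻¹ • (u * p) := by
    have h4 : c • (u * p * R) = u * p + u * p * R * (g * p) := by
      rw [← mul_smul_comm, Rn, mul_add, mul_one, mul_assoc (u * p)]
    rw [← yp, mul_assoc, pg, yp, hy, smul_comm c, h4, _root_.smul_add, smul_mul_assoc]
    abel
  have kill : ∀ {a b : A}, a * e = 0 → e * b = b → a * b = 0 := fun {a b} ha hb => by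
    rw [← hb, ← mul_assoc, ha, zero_mul]
  have gu := kill ge eu
  have gy := kill ge ey
  have vu := kill ve eu
  have vy := kill ve ey
  have uu := kill ue eu
  have uy := kill ue ey
  have yu := kill ye eu
  have yy := kill ye ey
  have hxb : (c • e + w) * (c⁻¹ • e - c⁻¹ • (u * v) + y + v) = e + c • y + g * v := by
    rw [hwug]
    simp only [add_mul, mul_add, mul_sub, smul_mul_assoc, mul_smul_comm, he, ← mul_assoc,
      eu, ey, ev, ue, uu, uy, ge, gu, gy, zero_mul, smul_zero]
    match_scalars <;> field_simp <;> ring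
  have hbx : (c⁻¹ • e - c⁻¹ • (u * v) + y + v) * (c • e + w) = e + c • y + g * v := by
    have h4 : u * v * g = u - u * p := by
      rw [hp, mul_assoc, ← h1]; noncomm_ring
    rw [hwug]
    simp only [add_mul, mul_add, sub_mul, smul_mul_assoc, mul_smul_comm, he, h4, mul_assoc u v,
      eu, eg, ve, vu, ye, yu, yg, ← h1, mul_zero, smul_zero, smul_sub]
    match_scalars <;> field_simp <;> ring
  refine ⟨c⁻¹ • e - c⁻¹ • (u * v) + y + v, hxb.trans hbx.symm, ?_, ?_⟩
  · rw [hbx]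
    have hgv : g * v * v = v := by rw [h1, h2]
    simp only [add_mul, mul_add, mul_sub, smul_mul_assoc, mul_smul_comm, he, ← mul_assoc,
      eu, ey, ev, ye, yu, yy, yv, mul_assoc g v e, mul_assoc g v u, mul_assoc g v y, ve, vu, vy,
      hgv, mul_zero, zero_mul, smul_zero]
    abel
  · rw [hxb]
    -- The residual `M` satisfies `M = M(1 - e)`, and its swap `(1 - e)M` is `gp`, the residual of
    -- `g`.
    have hM : (c • e + w) * (1 - (e + c • y + g * v)) * (1 - e) =
        (c • e + w) * (1 - (e + c • y + g * v)) := by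
      have : (1 - (e + c • y + g * v)) * e = 0 := by
        rw [sub_mul, add_mul, add_mul, smul_mul_assoc, ye, mul_assoc, ve, he]
        simp
      rw [mul_sub, mul_assoc _ _ e, this, mul_one, mul_zero, sub_zero]
    rw [← hM]
    apply hN
    have h4 : (1 - e) * (c • e + w) = g := by
      rw [mul_add, ← hg, mul_smul_comm, sub_mul, he]
      simp
    have h5 : g * (1 - (e + c • y + g * v)) = g * p := by
      rw [hp, mul_sub, mul_sub, mul_add, mul_add, mul_smul_comm, gy, ge]
      simp
    rwa [← mul_assoc, h4, h5]

theorem isDrazinInvertibleRel_smul_add_iff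
    (hN : ∀ x y, N (x * y) → N (y * x))
    (hU : ∀ x, N x → ∀ c : K, c ≠ 0 → IsUnit (algebraMap K A c - x))
    {e w : A} {c : K} (hc : c ≠ 0) (he : e * e = e) (hw : w * e = 0) :
    IsDrazinInvertibleRel N (c • e + w) ↔ IsDrazinInvertibleRel N w :=
  ⟨.of_smul_add hN hU hc he hw, .smul_add hN hU hc he hw⟩

open MulOpposite in
theorem isDrazinInvertibleRel_op_iff {A : Type*} [Ring A] {N : A → Prop} {a : A} :
    IsDrazinInvertibleRel (fun x : Aᵐᵒᵖ => N (unop x)) (op a) ↔ IsDrazinInvertibleRel N a := by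
  have key : ∀ b : A, a * b = b * a → (1 - b * a) * a = a * (1 - a * b) := fun b h => by
    rw [sub_mul, mul_sub, ← h, mul_assoc a b a, ← h, one_mul, mul_one]
  constructor
  · rintro ⟨b, h1, h2, h3⟩
    have h1' : a * unop b = unop b * a := (congrArg unop h1).symm
    refine ⟨unop b, h1', ?_, ?_⟩
    · simpa [mul_assoc] using congrArg unop h2
    · rw [← key _ h1']
      simpa using h3
  · rintro ⟨b, h1, h2, h3⟩
    refine ⟨op b, congrArg op h1.symm, ?_, ?_⟩
    · apply unop_injective
      simpa [mul_assoc] using h2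
    · rw [← key _ h1] at h3
      simpa using h3

open MulOpposite in
theorem isDrazinInvertibleRel_smul_add_iff'
    (hN : ∀ x y, N (x * y) → N (y * x))
    (hU : ∀ x, N x → ∀ c : K, c ≠ 0 → IsUnit (algebraMap K A c - x))
    {e w : A} {c : K} (hc : c ≠ 0) (he : e * e = e) (hw : e * w = 0) :
    IsDrazinInvertibleRel N (c • e + w) ↔ IsDrazinInvertibleRel N w := by
  rw [← isDrazinInvertibleRel_op_iff, ← isDrazinInvertibleRel_op_iff (a := w), op_add, op_smul]
  exact isDrazinInvertibleRel_smul_add_iff (K := K) (N := fun x : Aᵐᵒᵖ => N (unop x))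
    (fun x y h => hN _ _ h)
    (fun x h k hk => (show IsUnit (algebraMap K A k - unop x) from hU _ h k hk).op) hc (unop_injective he) (unop_injective hw)

/-- Both sums reduce to their common summand `w`. -/
theorem isDrazinInvertibleRel_idempotent_add_iff
    (hN : ∀ x y, N (x * y) → N (y * x))
    (hU : ∀ x, N x → ∀ c : K, c ≠ 0 → IsUnit (algebraMap K A c - x))
    {p q w : A} (hp : IsIdempotentElem p) (hq : IsIdempotentElem q) {c d : K} (hc : c ≠ 0)
    (hd : d ≠ 0) (hpw : p * w = w) (hwq : w * q = 0) :
    IsDrazinInvertibleRel N (c • q + w) ↔ IsDrazinInvertibleRel N (d • (1 - p) + w) := by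
  rw [isDrazinInvertibleRel_smul_add_iff hN hU hc hq hwq,
    isDrazinInvertibleRel_smul_add_iff' hN hU hd hp.one_sub (by rw [sub_mul, hpw, one_mul, sub_self])]

end DrazinRelative

/-! ### The two classes of negligible elements -/

theorem IsNilpotent.mul_swap {A : Type*} [Ring A] {x y : A} (h : IsNilpotent (x * y)) :
    IsNilpotent (y * x) := by
  obtain ⟨n, hn⟩ := h
  refine ⟨n + 1, ?_⟩
  have : ∀ k : ℕ, (y * x) ^ (k + 1) = y * (x * y) ^ k * x := by
    intro k
    induction k with
    | zero => simp
    | succ k ih => rw [_root_.pow_succ, ih, _root_.pow_succ]; simp only [mul_assoc]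
  rw [this, hn, mul_zero, zero_mul]

theorem IsNilpotent.isUnit_algebraMap_sub {K A : Type*} [Field K] [Ring A] [Algebra K A] {x : A}
    (h : IsNilpotent x) {c : K} (hc : c ≠ 0) : IsUnit (algebraMap K A c - x) := by
  rw [sub_eq_add_neg]
  exact h.neg.isUnit_add_left_of_commute (hc.isUnit.map _)
    (Algebra.commutes c (-x)).symm

theorem isQuasinilpotent_iff {A : Type*} [Ring A] [Algebra ℂ A] {a : A} :
    IsQuasinilpotent a ↔ ∀ c : ℂ, c ≠ 0 → IsUnit (algebraMap ℂ A c - a) := by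
  simp only [IsQuasinilpotent, spectralRadius, ENNReal.iSup_eq_zero, ENNReal.coe_eq_zero,
    nnnorm_eq_zero, spectrum.mem_iff]
  exact forall_congr' fun c => not_imp_comm

theorem IsQuasinilpotent.mul_swap {A : Type*} [Ring A] [Algebra ℂ A] {x y : A}
    (h : IsQuasinilpotent (x * y)) : IsQuasinilpotent (y * x) := by
  rw [isQuasinilpotent_iff] at h ⊢
  intro c hc
  by_contra hn
  have : c ∈ spectrum ℂ (y * x) \ {0} := ⟨hn, hc⟩
  rw [spectrum.nonzero_mul_comm] at this
  exact this.1 (h c hc)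

theorem proposition3p1 {A : Type*} [NormedRing A] [NormedAlgebra ℂ A] [CompleteSpace A]
    (p q : A) (hp : IsIdempotentElem p) (hq : IsIdempotentElem q)
    (m : ℕ) (hm : 1 ≤ m) (γ₁ : ℂ) (lam : ℕ → ℂ) (h : lam 1 * γ₁ ≠ 0) :
    (IsDrazinInvertible
        (lam 1 • p + γ₁ • q - lam 1 • (p * q)
          + ∑ k ∈ Finset.Icc 2 m, lam k • ((p * q) ^ (k - 1) * p - (p * q) ^ k)) ↔
      IsDrazinInvertible
        (lam 1 • (1 : A) - lam 1 • (p * q)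
          + ∑ k ∈ Finset.Icc 2 m, lam k • ((p * q) ^ (k - 1) * p - (p * q) ^ k))) ∧
    (IsGDrazinInvertible
        (lam 1 • p + γ₁ • q - lam 1 • (p * q)
          + ∑ k ∈ Finset.Icc 2 m, lam k • ((p * q) ^ (k - 1) * p - (p * q) ^ k)) ↔
      IsGDrazinInvertible
        (lam 1 • (1 : A) - lam 1 • (p * q)
          + ∑ k ∈ Finset.Icc 2 m, lam k • ((p * q) ^ (k - 1) * p - (p * q) ^ k))) := by
  obtain ⟨hl, hg⟩ := mul_ne_zero_iff.1 h
  obtain ⟨s, hs⟩ : ∃ s, s = ∑ k ∈ Finset.Icc 2 m, lam k • ((p * q) ^ (k - 1) * p - (p * q) ^ k) :=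
    ⟨_, rfl⟩
  have hps : p * s = s := by
    rw [hs, Finset.mul_sum]
    refine Finset.sum_congr rfl fun k hk => ?_
    obtain ⟨j, rfl⟩ := Nat.exists_eq_add_of_le' (Finset.mem_Icc.1 hk).1
    have hpow : ∀ i : ℕ, p * (p * q) ^ (i + 1) = (p * q) ^ (i + 1) := fun i => by
      rw [pow_succ', ← mul_assoc, ← mul_assoc, hp.eq]
    rw [mul_smul_comm, mul_sub, ← mul_assoc, hpow (j + 1), show j + 2 - 1 = j + 1 from rfl, hpow]
  have hsq : s * q = 0 := by
    rw [hs, Finset.sum_mul]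
    refine Finset.sum_eq_zero fun k hk => ?_
    obtain ⟨j, rfl⟩ := Nat.exists_eq_add_of_le' (Finset.mem_Icc.1 hk).1
    have hpow : (p * q) ^ (j + 2) * q = (p * q) ^ (j + 2) := by
      rw [pow_succ, mul_assoc, mul_assoc p, hq.eq]
    -- The two terms cancel because `(pq)^(k-1) p q = (pq)^k`.
    rw [smul_mul_assoc, sub_mul, hpow, show j + 2 - 1 = j + 1 from rfl, mul_assoc, ← pow_succ,
      sub_self, smul_zero]
  rw [← hs]
  have hpw : p * (lam 1 • (p - p * q) + s) = lam 1 • (p - p * q) + s := by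
    rw [mul_add, hps, mul_smul_comm, mul_sub, ← mul_assoc, hp.eq]
  have hwq : (lam 1 • (p - p * q) + s) * q = 0 := by
    rw [add_mul, hsq, smul_mul_assoc, sub_mul, mul_assoc, hq.eq, sub_self, smul_zero, add_zero]
  have e1 : lam 1 • p + γ₁ • q - lam 1 • (p * q) + s = γ₁ • q + (lam 1 • (p - p * q) + s) := by
    module
  have e2 : lam 1 • (1 : A) - lam 1 • (p * q) + s =
      lam 1 • (1 - p) + (lam 1 • (p - p * q) + s) := by
    module
  rw [e1, e2]
  exact ⟨isDrazinInvertibleRel_idempotent_add_iff (N := IsNilpotent)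
      (fun _ _ => IsNilpotent.mul_swap) (fun _ hx _ => hx.isUnit_algebraMap_sub) hp hq hg hl hpw hwq,
    isDrazinInvertibleRel_idempotent_add_iff (N := IsQuasinilpotent)
      (fun _ _ => IsQuasinilpotent.mul_swap) (fun _ hx => isQuasinilpotent_iff.1 hx)
      hp hq hg hl hpw hwq⟩
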